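/- Let $n\in\mathbb N$ and let $L^2(\mathbb R^n)$ be the Hilbert space of real-valued, or of complex-valued, square integrable functions on $\mathbb R^n$ (Lebesgue measure), with norm $\|\cdot\|$; for a Lebesgue measurable set $E\subset\mathbb R^n$ put $\|f\|_{L^2(E)}:=\big(\int_E|f|^2\,dx\big)^{1/2}$, and let $\chi_E$ denote also the operator of multiplication by the characteristic function of $E$. Let $H$ be a (possibly unbounded) self-adjoint operator on $L^2(\mathbb R^n)$ such that $-H$ generates a $C_0$ semigroup $\{e^{-tH}\}_{t\ge 0}$ on $L^2(\mathbb R^n)$. Let $E\subset\mathbb R^n$ be Lebesgue measurable and let $\{\pi_k\}_{k=1,2,\dots}$ be a family of orthogonal projections on $L^2(\mathbb R^n)$. Suppose that there are constants $c_1,c_2,a,b,M>0$ such that, for every integer $k\ge 1$, the spectral inequality $$\|\pi_k\varphi\|\le e^{c_1k^a}\,\|\pi_k\varphi\|_{L^2(E)}\qquad\text{for all }\varphi\in L^2(\mathbb R^n)$$ and the dissipative inequality $$\|(1-\pi_k)(e^{-tH}\varphi)\|\le M e^{-c_2tk^b}\|\varphi\|\qquad\text{for all }\varphi\in L^2(\mathbb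 R^n),\ t>0,$$ hold (no relation between $a$ and $b$ is required). Then $E$ is a stabilizable set for the equation $(\partial_t+H)y=0$ on $(0,\infty)\times\mathbb R^n$; that is, there are a bounded linear operator $K$ on $L^2(\mathbb R^n)$ and constants $M'>0$, $\omega>0$ such that the $C_0$ semigroup $\{e^{-t(H-\chi_EK)}\}_{t\ge0}$ generated by $-(H-\chi_EK)$ (with the domain of $H$) satisfies $$\|e^{-t(H-\chi_EK)}\|_{\mathcal L(L^2(\mathbb R^n))}\le M'e^{-\omega t}\qquad\text{for all }t\ge 0 .$$ -/

import Mathlib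

open MeasureTheory Filter Topology

noncomputable section

/-- The Hilbert space `L²(ℝⁿ)` (Lebesgue measure) of `𝕜`-valued functions, `𝕜 = ℝ` or `ℂ`. -/
abbrev L2Rn (𝕜 : Type*) [RCLike 𝕜] (n : ℕ) : Type _ :=
  Lp 𝕜 2 (volume : Measure (EuclideanSpace ℝ (Fin n)))

/-- A `C₀` semigroup of bounded operators on `X`; only the values `S t` with `0 ≤ t` matter. -/
structure IsC0Semigroup {𝕜 X : Type*} [RCLike 𝕜] [NormedAddCommGroup X] [NormedSpace 𝕜 X]
    (S : ℝ → X →L[𝕜] X) : Prop where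
  map_zero : S 0 = ContinuousLinearMap.id 𝕜 X
  map_add : ∀ s t : ℝ, 0 ≤ s → 0 ≤ t → S (s + t) = (S s).comp (S t)
  tendsto_zero : ∀ x : X, Tendsto (fun t : ℝ => S t x) (𝓝[>] 0) (𝓝 x)

/-- The (unbounded) operator `A` generates the `C₀` semigroup `S`: its domain consists of those `x`
for which `(S t x - x) / t` converges as `t → 0+`, and the limit is then `A x`. -/
def GeneratesC0 {𝕜 X : Type*} [RCLike 𝕜] [NormedAddCommGroup X] [NormedSpace 𝕜 X]
    (A : X →ₗ.[𝕜] X) (S : ℝ → X →L[𝕜] X) : Prop :=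
  IsC0Semigroup S ∧
    ∀ x y : X, (x, y) ∈ A.graph ↔
      Tendsto (fun t : ℝ => ((t⁻¹ : ℝ) : 𝕜) • (S t x - x)) (𝓝[>] 0) (𝓝 y)

theorem memLp_indicator_of_nullMeasurableSet {𝕜 : Type*} [RCLike 𝕜] {n : ℕ}
    {E : Set (EuclideanSpace ℝ (Fin n))}
    (hE : NullMeasurableSet E volume) (f : L2Rn 𝕜 n) :
    MemLp (E.indicator f) 2 volume :=
  ⟨(Lp.memLp f).1.indicator₀ hE, (eLpNorm_indicator_le f).trans_lt (Lp.memLp f).2⟩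

/-- Multiplication by the characteristic function of the Lebesgue measurable set `E`, as a bounded
operator on `L²(ℝⁿ)`. -/
def chiMul (𝕜 : Type*) [RCLike 𝕜] {n : ℕ} {E : Set (EuclideanSpace ℝ (Fin n))}
    (hE : NullMeasurableSet E volume) : L2Rn 𝕜 n →L[𝕜] L2Rn 𝕜 n :=
  LinearMap.mkContinuous
    { toFun := fun f => (memLp_indicator_of_nullMeasurableSet hE f).toLp (E.indicator f)
      map_add' := by
        intro f g
        rw [← MemLp.toLp_add]
        apply MemLp.toLp_congr
        filter_upwards [Lp.coeFn_add f g] with x hx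
        by_cases h : x ∈ E
        · simpa only [Pi.add_apply, Set.indicator_of_mem h] using hx
        · simp [h]
      map_smul' := by
        intro c f
        rw [RingHom.id_apply, ← MemLp.toLp_const_smul]
        apply MemLp.toLp_congr
        filter_upwards [Lp.coeFn_smul c f] with x hx
        by_cases h : x ∈ E
        · simpa only [Pi.smul_apply, Set.indicator_of_mem h] using hx
        · simp [h] }
    1
    (by
      intro f
      rw [one_mul]
      apply Lp.norm_le_norm_of_ae_le
      filter_upwards [(memLp_indicator_of_nullMeasurableSet hE f).coeFn_toLp] with x hx
      simp only [LinearMap.coe_mk, AddHom.coe_mk, hx]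
      exact norm_indicator_le_norm_self _ _)

theorem chiMul_coeFn {𝕜 : Type*} [RCLike 𝕜] {n : ℕ} {E : Set (EuclideanSpace ℝ (Fin n))}
    (hE : NullMeasurableSet E volume)
    (f : L2Rn 𝕜 n) : ⇑(chiMul 𝕜 hE f) =ᵐ[volume] E.indicator f :=
  (memLp_indicator_of_nullMeasurableSet hE f).coeFn_toLp

/-- The norm `‖f‖_{L²(E)}` of the restriction to `E` of a function `f` in `L²(ℝⁿ)`. -/
def normOn {𝕜 : Type*} [RCLike 𝕜] {n : ℕ} (E : Set (EuclideanSpace ℝ (Fin n)))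
    (f : L2Rn 𝕜 n) : ℝ :=
  (eLpNorm f 2 (volume.restrict E)).toReal

/-- The measurable set `E` is stabilizable for `∂ₜ y + H y = 0`: there is a bounded operator `K` on
`L²(ℝⁿ)` such that `-(H - χ_E K)`, with the domain of `H`, generates a `C₀` semigroup
`e^{-t(H - χ_E K)}` and `‖e^{-t(H - χ_E K)}‖ ≤ M e^{-ω t}` for all `t ≥ 0`, with some constants
`M, ω > 0`. -/
def IsStabilizableSet {𝕜 : Type*} [RCLike 𝕜] {n : ℕ} (H : L2Rn 𝕜 n →ₗ.[𝕜] L2Rn 𝕜 n)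
    {E : Set (EuclideanSpace ℝ (Fin n))} (hE : NullMeasurableSet E volume) : Prop :=
  ∃ (K : L2Rn 𝕜 n →L[𝕜] L2Rn 𝕜 n) (S : ℝ → L2Rn 𝕜 n →L[𝕜] L2Rn 𝕜 n),
    GeneratesC0 (-(H - ((chiMul 𝕜 hE).comp K).toLinearMap.toPMap ⊤)) S ∧
      ∃ M ω : ℝ, 0 < M ∧ 0 < ω ∧ ∀ t : ℝ, 0 ≤ t → ‖S t‖ ≤ M * Real.exp (-ω * t)

end

/-! A single `k` suffices. Fix `k` with `c₂ k^b ≥ 2` and put `C = exp (c₁ k^a)`, `m = 16 C² (M² +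
1)`. Since `k` is chosen before the time `m`, the growth of `C` in `k` never competes with the
dissipation rate, and `a`, `b` need not be related. The feedback is explicit: `K = -(8 C² / m) S m`.

The closed loop is a bounded perturbation of `-H`, so it generates a semigroup
(`exists_bounded_perturbation`). Its decay follows from the Lyapunov form `⟨S m y, y⟩ + 2 e^{-2m}
‖y‖²`. The spectral and dissipative inequalities at time `m` give `‖S m y‖ ≤ C ‖χ S m y‖ + (C + 1) M
e^{-2m} ‖y‖`. The feedback supplies `-‖χ S m y‖²`, and the convexity bound `1 - tH ≤ e^{-tH}`
controls the terms with `H`, which need not be nonnegative. Together they make the form strictly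
decreasing (`lyapunov_dissipation`), and Gronwall gives exponential decay
(`exists_exp_decay_of_lyapunov`). -/

/-! ### Growth, strong continuity and differentiation of C₀ semigroups. -/

theorem tendsto_sub_nhdsGT (t : ℝ) : Tendsto (fun r => r - t) (𝓝[>] t) (𝓝[>] 0) := by
  refine tendsto_nhdsWithin_iff.2 ⟨?_, ?_⟩
  · have h : Continuous fun r : ℝ => r - t := by fun_prop
    simpa using (h.tendsto t).mono_left (nhdsWithin_le_nhds (s := Set.Ioi t))
  · filter_upwards [self_mem_nhdsWithin] with r hr using sub_pos.2 (Set.mem_Ioi.1 hr)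

/-- The pair `(x, a)` belongs to the graph of the generator of `S`. -/
def IsGeneratorPair {𝕜 X : Type*} [RCLike 𝕜] [NormedAddCommGroup X] [NormedSpace 𝕜 X]
    (S : ℝ → X →L[𝕜] X) (x a : X) : Prop :=
  Tendsto (fun t : ℝ => ((t⁻¹ : ℝ) : 𝕜) • (S t x - x)) (𝓝[>] 0) (𝓝 a)

namespace IsC0Semigroup

section Basic

variable {𝕜 X : Type*} [RCLike 𝕜] [NormedAddCommGroup X] [NormedSpace 𝕜 X] {S : ℝ → X →L[𝕜] X}

theorem apply_zero (hS : IsC0Semigroup S) (x : X) : S 0 x = x := by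
  simp [hS.map_zero]

theorem apply_add (hS : IsC0Semigroup S) {s t : ℝ} (hs : 0 ≤ s) (ht : 0 ≤ t) (x : X) :
    S (s + t) x = S s (S t x) := by
  simp [hS.map_add s t hs ht]

theorem tendsto_nhdsGE (hS : IsC0Semigroup S) (x : X) :
    Tendsto (fun t => S t x) (𝓝[≥] 0) (𝓝 x) := by
  have h : ContinuousWithinAt (fun t => S t x) (Set.Ioi 0) 0 := by
    simpa [ContinuousWithinAt, hS.apply_zero] using hS.tendsto_zero x
  simpa [ContinuousWithinAt, hS.apply_zero] using continuousWithinAt_Ioi_iff_Ici.1 h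

/-- Otherwise norms blow up along some `t n → 0+`, although each orbit `S (t n) x` converges: this
contradicts Banach–Steinhaus. -/
theorem exists_bound_near_zero [CompleteSpace X] (hS : IsC0Semigroup S) :
    ∃ d > 0, ∃ M, 1 ≤ M ∧ ∀ t, 0 ≤ t → t ≤ d → ‖S t‖ ≤ M := by
  by_contra! h
  have h' : ∀ n : ℕ, ∃ t : ℝ, 0 ≤ t ∧ t ≤ 1 / ((n : ℝ) + 1) ∧ (n : ℝ) + 1 < ‖S t‖ := fun n =>
    h _ (by positivity) _ (by linarith [n.cast_nonneg (α := ℝ)])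
  choose t ht0 ht1 ht2 using h'
  have htt : Tendsto t atTop (𝓝[≥] 0) := by
    refine tendsto_nhdsWithin_iff.2 ⟨?_, Eventually.of_forall ht0⟩
    exact squeeze_zero ht0 ht1 tendsto_one_div_add_atTop_nhds_zero_nat
  obtain ⟨C, hC⟩ := banach_steinhaus (g := fun n => S (t n)) (fun x => by
    obtain ⟨C, hC⟩ := ((hS.tendsto_nhdsGE x).comp htt).norm.bddAbove_range
    exact ⟨C, fun n => hC ⟨n, rfl⟩⟩)
  obtain ⟨n, hn⟩ := exists_nat_gt C
  linarith [hC n, ht2 n]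

theorem exists_norm_le_exp [CompleteSpace X] (hS : IsC0Semigroup S) :
    ∃ M w : ℝ, 1 ≤ M ∧ 0 ≤ w ∧ ∀ t, 0 ≤ t → ‖S t‖ ≤ M * Real.exp (w * t) := by
  obtain ⟨d, hd, M, hM, hb⟩ := hS.exists_bound_near_zero
  have hstep : ∀ n : ℕ, ∀ t, 0 ≤ t → t ≤ d → ‖S (n * d + t)‖ ≤ M * M ^ n := by
    intro n
    induction n with
    | zero => intro t h0 h1; simpa using hb t h0 h1
    | succ n ih =>
      intro t h0 h1
      have e : ((n + 1 : ℕ) : ℝ) * d + t = d + (n * d + t) := by push_cast; ring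
      rw [e, hS.map_add _ _ hd.le (by positivity)]
      calc _ ≤ ‖S d‖ * ‖S (n * d + t)‖ := ContinuousLinearMap.opNorm_comp_le _ _
        _ ≤ M * (M * M ^ n) := by
          gcongr
          · exact hb d hd.le le_rfl
          · exact ih t h0 h1
        _ = _ := by ring
  refine ⟨M, Real.log M / d, hM, div_nonneg (Real.log_nonneg hM) hd.le, fun t ht => ?_⟩
  have h1 : (⌊t / d⌋₊ : ℝ) ≤ t / d := Nat.floor_le (by positivity)
  have h2 : t / d < ⌊t / d⌋₊ + 1 := Nat.lt_floor_add_one _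
  have e : t = ⌊t / d⌋₊ * d + (t - ⌊t / d⌋₊ * d) := by ring
  have h3 : (⌊t / d⌋₊ : ℝ) * d ≤ t := (le_div_iff₀ hd).1 h1
  have h4 : t < (⌊t / d⌋₊ + 1) * d := (div_lt_iff₀ hd).1 h2
  calc ‖S t‖ ≤ M * M ^ ⌊t / d⌋₊ := by
        conv_lhs => rw [e]
        exact hstep _ _ (by linarith) (by linarith)
    _ ≤ M * Real.exp (Real.log M / d * t) := by
        have h5 : M ^ ⌊t / d⌋₊ = Real.exp (⌊t / d⌋₊ * Real.log M) := by
          rw [Real.exp_nat_mul, Real.exp_log (by linarith)]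
        rw [h5]
        refine mul_le_mul_of_nonneg_left (Real.exp_le_exp.2 ?_) (by linarith)
        calc _ ≤ t / d * Real.log M := mul_le_mul_of_nonneg_right h1 (Real.log_nonneg hM)
          _ = _ := by ring

/-- Factoring out the smaller of the two times reduces continuity at any time to continuity at `0`.
-/
theorem norm_sub_le (hS : IsC0Semigroup S) {M w : ℝ} (hM : 0 ≤ M) (hw : 0 ≤ w)
    (hb : ∀ t, 0 ≤ t → ‖S t‖ ≤ M * Real.exp (w * t)) {s t : ℝ} (hs : 0 ≤ s) (ht : 0 ≤ t) (x : X) :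
    ‖S t x - S s x‖ ≤ M * Real.exp (w * t) * ‖S |t - s| x - x‖ := by
  rcases le_total s t with h | h
  · have e : t = s + (t - s) := by ring
    rw [abs_of_nonneg (sub_nonneg.2 h)]
    conv_lhs => rw [e, hS.apply_add hs (sub_nonneg.2 h), ← map_sub]
    refine ((S s).le_opNorm _).trans ?_
    gcongr
    exact (hb s hs).trans (by gcongr)
  · have e : s = t + (s - t) := by ring
    rw [abs_sub_comm, abs_of_nonneg (sub_nonneg.2 h), norm_sub_rev]
    conv_lhs => rw [e, hS.apply_add ht (sub_nonneg.2 h), ← map_sub]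
    refine ((S t).le_opNorm _).trans ?_
    gcongr
    exact hb t ht

/-- Strong continuity, jointly in time and space; times are truncated to `[0, ∞)`. -/
theorem continuous_uncurry [CompleteSpace X] (hS : IsC0Semigroup S) :
    Continuous fun p : ℝ × X => S (max p.1 0) p.2 := by
  obtain ⟨M, w, hM, hw, hb⟩ := hS.exists_norm_le_exp
  have hM0 : 0 ≤ M := by linarith
  rw [continuous_iff_continuousAt]
  rintro ⟨s, x⟩
  rw [ContinuousAt, tendsto_iff_norm_sub_tendsto_zero]
  have hle : ∀ p : ℝ × X, ‖S (max p.1 0) p.2 - S (max s 0) x‖ ≤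
      M * Real.exp (w * max p.1 0) * (‖p.2 - x‖ + ‖S |max p.1 0 - max s 0| x - x‖) := by
    intro p
    have e : S (max p.1 0) p.2 - S (max s 0) x =
        S (max p.1 0) (p.2 - x) + (S (max p.1 0) x - S (max s 0) x) := by
      rw [map_sub]; abel
    rw [e, mul_add]
    refine (norm_add_le _ _).trans (add_le_add ?_ ?_)
    · refine ((S _).le_opNorm _).trans ?_
      gcongr
      exact hb _ (le_max_right _ _)
    · exact hS.norm_sub_le hM0 hw hb (le_max_right _ _) (le_max_right _ _) x
  refine squeeze_zero (fun _ => norm_nonneg _) hle ?_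
  have h1 : Tendsto (fun p : ℝ × X => |max p.1 0 - max s 0|) (𝓝 (s, x)) (𝓝[≥] 0) := by
    refine tendsto_nhdsWithin_iff.2 ⟨?_, Eventually.of_forall fun _ => Set.mem_Ici.2 (abs_nonneg _)⟩
    have : Continuous fun p : ℝ × X => |max p.1 0 - max s 0| := by fun_prop
    simpa using this.tendsto (s, x)
  have h2 := ((hS.tendsto_nhdsGE x).comp h1).sub_const x |>.norm
  have h3 : Tendsto (fun p : ℝ × X => M * Real.exp (w * max p.1 0)) (𝓝 (s, x))
      (𝓝 (M * Real.exp (w * max s 0))) :=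
    (show Continuous fun p : ℝ × X => M * Real.exp (w * max p.1 0) by fun_prop).tendsto (s, x)
  have h4 : Tendsto (fun p : ℝ × X => ‖p.2 - x‖) (𝓝 (s, x)) (𝓝 0) := by
    simpa using (show Continuous fun p : ℝ × X => ‖p.2 - x‖ by fun_prop).tendsto (s, x)
  simpa using h3.mul (h4.add h2)

theorem tendsto_apply [CompleteSpace X] (hS : IsC0Semigroup S) {ι : Type*} {l : Filter ι}
    {r : ι → ℝ} {u : ι → X} {s : ℝ} {x : X} (hr : Tendsto r l (𝓝 s)) (hu : Tendsto u l (𝓝 x))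
    (hs : 0 ≤ s) (hr0 : ∀ᶠ i in l, 0 ≤ r i) :
    Tendsto (fun i => S (r i) (u i)) l (𝓝 (S s x)) := by
  have h := (hS.continuous_uncurry.tendsto (s, x)).comp (hr.prodMk_nhds hu)
  simp only [max_eq_left hs] at h
  refine h.congr' ?_
  filter_upwards [hr0] with i hi
  simp [max_eq_left hi]

theorem continuousOn_apply [CompleteSpace X] (hS : IsC0Semigroup S) (x : X) :
    ContinuousOn (fun t => S t x) (Set.Ici 0) := fun _ ht =>
  hS.tendsto_apply (tendsto_id.mono_left nhdsWithin_le_nhds) tendsto_const_nhds ht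
    self_mem_nhdsWithin

/-- Exponential rescaling of a `C₀` semigroup. -/
theorem exp_smul (hS : IsC0Semigroup S) (w : ℝ) :
    IsC0Semigroup fun t => ((Real.exp (w * t) : ℝ) : 𝕜) • S t where
  map_zero := by simp [hS.map_zero]
  map_add s t hs ht := by
    ext x
    simp only [hS.map_add s t hs ht, smul_apply,
      ContinuousLinearMap.comp_apply, map_smul, smul_smul, mul_add, Real.exp_add,
      RCLike.ofReal_mul]
    rw [mul_comm]
  tendsto_zero x := by
    have h : Tendsto (fun t : ℝ => ((Real.exp (w * t) : ℝ) : 𝕜)) (𝓝[>] 0) (𝓝 1) := by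
      have : Continuous fun t : ℝ => ((Real.exp (w * t) : ℝ) : 𝕜) := by fun_prop
      simpa using (this.tendsto 0).mono_left nhdsWithin_le_nhds
    simpa using h.smul (hS.tendsto_zero x)

end Basic

end IsC0Semigroup

namespace IsGeneratorPair

variable {𝕜 X : Type*} [RCLike 𝕜] [NormedAddCommGroup X] [NormedSpace 𝕜 X] {S : ℝ → X →L[𝕜] X}
  {x a : X}

theorem map (hS : IsC0Semigroup S) (h : IsGeneratorPair S x a) {s : ℝ} (hs : 0 ≤ s) :
    IsGeneratorPair S (S s x) (S s a) := by
  have := ((S s).continuous.tendsto a).comp h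
  refine this.congr' ?_
  filter_upwards [self_mem_nhdsWithin] with t ht
  have ht : 0 ≤ t := le_of_lt ht
  simp only [Function.comp_apply, map_smul, map_sub]
  rw [← hS.apply_add hs ht, ← hS.apply_add ht hs, add_comm]

theorem exp_smul (hS : IsC0Semigroup S) (h : IsGeneratorPair S x a) (w : ℝ) :
    IsGeneratorPair (fun t => ((Real.exp (w * t) : ℝ) : 𝕜) • S t) x (a + (w : 𝕜) • x) := by
  have h1 : Tendsto (fun t : ℝ => ((t⁻¹ * (Real.exp (w * t) - 1) : ℝ) : 𝕜)) (𝓝[>] 0)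
      (𝓝 (w : 𝕜)) := by
    have hd : HasDerivWithinAt (fun t => Real.exp (w * t)) w (Set.Ioi 0) 0 := by
      simpa using (((hasDerivAt_id (0 : ℝ)).const_mul w).exp).hasDerivWithinAt
    rw [hasDerivWithinAt_iff_tendsto_slope' (by simp)] at hd
    refine ((RCLike.continuous_ofReal (K := 𝕜)).tendsto w).comp (hd.congr fun t => ?_)
    simp [slope_def_field, div_eq_inv_mul]
  have h2 := h.add (h1.smul (hS.tendsto_zero x))
  refine h2.congr fun t => ?_
  simp only [smul_apply, RCLike.ofReal_mul, RCLike.ofReal_sub,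
    smul_sub, mul_sub, sub_smul, mul_smul, mul_one]
  abel

theorem iff_exp_smul (hS : IsC0Semigroup S) (w : ℝ) :
    IsGeneratorPair (fun t => ((Real.exp (w * t) : ℝ) : 𝕜) • S t) x a ↔
      IsGeneratorPair S x (a - (w : 𝕜) • x) := by
  constructor
  · intro h
    have := h.exp_smul (hS.exp_smul w) (-w)
    have e : (fun t => ((Real.exp (-w * t) : ℝ) : 𝕜) • ((Real.exp (w * t) : ℝ) : 𝕜) • S t) = S := by
      funext t
      rw [smul_smul, ← RCLike.ofReal_mul, ← Real.exp_add]
      simp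
    rw [e] at this
    simpa [sub_eq_add_neg] using this
  · intro h
    simpa using h.exp_smul hS w

variable [NormedSpace ℝ X] [IsScalarTower ℝ 𝕜 X]

theorem hasDerivWithinAt (hS : IsC0Semigroup S) (h : IsGeneratorPair S x a) {t : ℝ} (ht : 0 ≤ t) :
    HasDerivWithinAt (fun r => S r x) (S t a) (Set.Ici t) t := by
  rw [← hasDerivWithinAt_Ioi_iff_Ici, hasDerivWithinAt_iff_tendsto_slope' (by simp)]
  have hr : Tendsto (fun r => r - t) (𝓝[>] t) (𝓝[>] 0) := tendsto_sub_nhdsGT t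
  refine ((h.map hS ht).comp hr).congr' ?_
  filter_upwards [self_mem_nhdsWithin] with r hr
  have hr : 0 ≤ r - t := (sub_pos.2 hr).le
  simp only [Function.comp_apply, slope, vsub_eq_sub]
  rw [← hS.apply_add hr ht, sub_add_cancel, RCLike.real_smul_eq_coe_smul (K := 𝕜)]

/-- The slope is `-S (t - r)` applied to the difference quotient of `x` at time `r - s`; operator
and vector both vary with `r`, hence the use of joint continuity. -/
theorem hasDerivWithinAt_const_sub [CompleteSpace X] (hS : IsC0Semigroup S) (h : IsGeneratorPair S x a) {s t : ℝ}
    (hst : s < t) :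
    HasDerivWithinAt (fun r => S (t - r) x) (-S (t - s) a) (Set.Ici s) s := by
  rw [← hasDerivWithinAt_Ioi_iff_Ici, hasDerivWithinAt_iff_tendsto_slope' (by simp)]
  have hr : Tendsto (fun r => r - s) (𝓝[>] s) (𝓝[>] 0) := tendsto_sub_nhdsGT s
  have hr' : Tendsto (fun r => t - r) (𝓝[>] s) (𝓝 (t - s)) :=
    ((continuous_const.sub continuous_id).tendsto s).mono_left nhdsWithin_le_nhds
  have hlt : ∀ᶠ r in 𝓝[>] s, r < t := nhdsWithin_le_nhds (Iio_mem_nhds hst)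
  have hmain := hS.tendsto_apply hr' (h.comp hr) (sub_pos.2 hst).le
    (by filter_upwards [hlt] with r h using (sub_pos.2 h).le)
  refine hmain.neg.congr' ?_
  filter_upwards [self_mem_nhdsWithin, hlt] with r hr hrt
  have hr : 0 ≤ r - s := (sub_pos.2 hr).le
  simp only [Function.comp_apply, slope, vsub_eq_sub, map_smul, map_sub]
  rw [← hS.apply_add (sub_pos.2 hrt).le hr, RCLike.real_smul_eq_coe_smul (K := 𝕜), ← smul_neg,
    neg_sub]
  simp

end IsGeneratorPair

open scoped BoundedContinuousFunction

/-! ### Bounded perturbations through the variation of constants formula. -/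

section Perturbation

variable {𝕜 X : Type*} [RCLike 𝕜] [NormedAddCommGroup X] [NormedSpace 𝕜 X]
  {S : ℝ → X →L[𝕜] X}

/-- The integral `∫₀ᵗ S(t - s) B u(s) ds` of the variation of constants formula. -/
noncomputable def duhamel [NormedSpace ℝ X] (S : ℝ → X →L[𝕜] X) (B : X →L[𝕜] X) (u : ℝ → X) (t : ℝ) : X :=
  ∫ s in (0 : ℝ)..max t 0, S (max (max t 0 - s) 0) (B (u s))

namespace IsC0Semigroup

theorem continuous_duhamel_integrand [CompleteSpace X] (hS : IsC0Semigroup S) (B : X →L[𝕜] X) {u : ℝ → X}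
    (hu : Continuous u) :
    Continuous (Function.uncurry fun t s : ℝ => S (max (max t 0 - s) 0) (B (u s))) := by
  have h : Continuous fun p : ℝ × ℝ => (max p.1 0 - p.2, B (u p.2)) := by fun_prop
  exact hS.continuous_uncurry.comp h

theorem intervalIntegrable_duhamel [CompleteSpace X] (hS : IsC0Semigroup S) (B : X →L[𝕜] X) {u : ℝ → X}
    (hu : Continuous u) (t a b : ℝ) :
    IntervalIntegrable (fun s => S (max (t - s) 0) (B (u s))) volume a b := by
  have h : Continuous fun s : ℝ => (t - s, B (u s)) := by fun_prop
  exact (hS.continuous_uncurry.comp h).intervalIntegrable a b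

variable [NormedSpace ℝ X]

/-- The factor `M ‖B‖ / r` comes from `∫ e^{-rs} ds ≤ 1 / r`; it is the contraction constant of the
fixed point problem. -/
theorem norm_duhamel_le {M r : ℝ} (hr : 0 < r) (hM : 0 ≤ M)
    (hb : ∀ t, 0 ≤ t → ‖S t‖ ≤ M * Real.exp (-r * t)) (B : X →L[𝕜] X) {u : ℝ → X} {C : ℝ}
    (hC : 0 ≤ C) (hu : ∀ t, ‖u t‖ ≤ C) (t : ℝ) :
    ‖duhamel S B u t‖ ≤ M * ‖B‖ / r * C := by
  have hb' : ∀ s ∈ Set.Ioc 0 (max t 0), ‖S (max (max t 0 - s) 0) (B (u s))‖ ≤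
      M * ‖B‖ * C * Real.exp (-r * (max t 0 - s)) := by
    intro s hs
    have h0 : 0 ≤ max t 0 - s := sub_nonneg.2 hs.2
    rw [max_eq_left h0]
    calc _ ≤ ‖S (max t 0 - s)‖ * (‖B‖ * ‖u s‖) :=
          ((S _).le_opNorm _).trans (by gcongr; exact B.le_opNorm _)
      _ ≤ M * Real.exp (-r * (max t 0 - s)) * (‖B‖ * C) := by
          gcongr
          · exact hb _ h0
          · exact hu s
      _ = _ := by ring
  have hint : ∫ s in (0 : ℝ)..max t 0, Real.exp (-r * (max t 0 - s)) =
      (1 - Real.exp (-r * max t 0)) / r := by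
    rw [intervalIntegral.integral_comp_sub_left (fun s => Real.exp (-r * s)),
      intervalIntegral.integral_comp_mul_left (fun s => Real.exp s) (by linarith : -r ≠ 0)]
    simp only [sub_self, sub_zero, mul_zero, integral_exp, Real.exp_zero, smul_eq_mul]
    field_simp
    ring
  refine (intervalIntegral.norm_integral_le_of_norm_le (le_max_right t 0)
    (Eventually.of_forall hb') (Continuous.intervalIntegrable (by fun_prop) _ _)).trans ?_
  rw [intervalIntegral.integral_const_mul, hint]
  calc M * ‖B‖ * C * ((1 - Real.exp (-r * max t 0)) / r) ≤ M * ‖B‖ * C * (1 / r) := by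
        gcongr
        linarith [Real.exp_pos (-r * max t 0)]
    _ = _ := by ring

theorem duhamel_smul (B : X →L[𝕜] X) (c : 𝕜) (u : ℝ → X) (t : ℝ) [SMulCommClass ℝ 𝕜 X] :
    duhamel S B (c • u) t = c • duhamel S B u t := by
  unfold duhamel
  rw [← intervalIntegral.integral_smul]
  simp

variable [CompleteSpace X]

theorem continuous_duhamel (hS : IsC0Semigroup S) (B : X →L[𝕜] X) {u : ℝ → X}
    (hu : Continuous u) : Continuous (duhamel S B u) :=
  intervalIntegral.continuous_parametric_intervalIntegral_of_continuous
    (hS.continuous_duhamel_integrand B hu) (by fun_prop)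

theorem duhamel_add (hS : IsC0Semigroup S) (B : X →L[𝕜] X) {u v : ℝ → X} (hu : Continuous u)
    (hv : Continuous v) (t : ℝ) : duhamel S B (u + v) t = duhamel S B u t + duhamel S B v t := by
  unfold duhamel
  rw [← intervalIntegral.integral_add (hS.intervalIntegrable_duhamel B hu _ _ _)
    (hS.intervalIntegrable_duhamel B hv _ _ _)]
  simp

/-- Split the integral at `s` and translate the second piece; this yields the semigroup law for mild
solutions. -/
theorem apply_add_duhamel (hS : IsC0Semigroup S) (B : X →L[𝕜] X) {u : ℝ → X} (hu : Continuous u)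
    {s t : ℝ} (hs : 0 ≤ s) (ht : 0 ≤ t) :
    duhamel S B u (t + s) =
      S t (duhamel S B u s) + duhamel S B (fun r => u (max r 0 + s)) t := by
  unfold duhamel
  rw [max_eq_left (add_nonneg ht hs), max_eq_left hs, max_eq_left ht,
    ← intervalIntegral.integral_add_adjacent_intervals
      (hS.intervalIntegrable_duhamel B hu (t + s) 0 s)
      (hS.intervalIntegrable_duhamel B hu (t + s) s (t + s)),
    ← (S t).intervalIntegral_comp_comm (hS.intervalIntegrable_duhamel B hu s 0 s)]
  congr 1
  · refine intervalIntegral.integral_congr fun r hr => ?_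
    rw [Set.uIcc_of_le hs] at hr
    have h : 0 ≤ s - r := sub_nonneg.2 hr.2
    rw [max_eq_left h, max_eq_left (by linarith), ← hS.apply_add ht h]
    ring_nf
  · have := intervalIntegral.integral_comp_add_right (a := 0) (b := t)
      (fun r => S (max (t + s - r) 0) (B (u r))) s
    rw [zero_add] at this
    rw [← this]
    refine intervalIntegral.integral_congr fun r hr => ?_
    rw [Set.uIcc_of_le ht] at hr
    simp only
    rw [max_eq_left hr.1]
    ring_nf

theorem tendsto_inv_smul_duhamel [IsScalarTower ℝ 𝕜 X] (hS : IsC0Semigroup S) (B : X →L[𝕜] X)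
    {u : ℝ → X} (hu : Continuous u) :
    Tendsto (fun t : ℝ => ((t⁻¹ : ℝ) : 𝕜) • duhamel S B u t) (𝓝[>] 0) (𝓝 (B (u 0))) := by
  rw [Metric.tendsto_nhds]
  intro e he
  have hc := (hS.continuous_duhamel_integrand B hu).tendsto (0, 0)
  simp only [Function.uncurry, max_self, sub_zero, hS.apply_zero] at hc
  rw [Metric.tendsto_nhds] at hc
  obtain ⟨d, hd, hd'⟩ := Metric.eventually_nhds_iff.1 (hc (e / 2) (half_pos he))
  filter_upwards [Ioo_mem_nhdsGT hd] with t ht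
  have hb : ∀ s ∈ Set.uIoc 0 t,
      ‖S (max (max t 0 - s) 0) (B (u s)) - B (u 0)‖ ≤ e / 2 := by
    intro s hs
    rw [Set.uIoc_of_le ht.1.le] at hs
    have := hd' (y := (t, s)) (by
      rw [Prod.dist_eq, max_lt_iff]
      simp only [Real.dist_eq, sub_zero, abs_of_pos ht.1, abs_of_pos hs.1]
      exact ⟨ht.2, hs.2.trans_lt ht.2⟩)
    rw [← dist_eq_norm]
    exact this.le
  have hn := intervalIntegral.norm_integral_le_of_norm_le_const hb
  rw [intervalIntegral.integral_sub (hS.intervalIntegrable_duhamel B hu _ _ _) (by simp),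
    intervalIntegral.integral_const, sub_zero, abs_of_pos ht.1] at hn
  have e1 : ((t⁻¹ : ℝ) : 𝕜) • duhamel S B u t - B (u 0) =
      t⁻¹ • ((∫ s in (0 : ℝ)..t, S (max (max t 0 - s) 0) (B (u s))) - t • B (u 0)) := by
    rw [smul_sub, smul_smul, inv_mul_cancel₀ ht.1.ne', one_smul,
      RCLike.real_smul_eq_coe_smul (K := 𝕜), duhamel, max_eq_left ht.1.le]
  rw [dist_eq_norm, e1, norm_smul, Real.norm_of_nonneg (inv_nonneg.2 ht.1.le)]
  calc _ ≤ t⁻¹ * (e / 2 * t) := by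
        gcongr
        exact inv_nonneg.2 ht.1.le
    _ = e / 2 := by field_simp [ht.1.ne']
    _ < e := half_lt_self he

variable [IsScalarTower ℝ 𝕜 X]

/-- Existence and uniqueness of bounded mild solutions for a small perturbation of an exponentially
decaying semigroup. -/
theorem exists_mild_solution_operator (hS : IsC0Semigroup S) {M r : ℝ} (hr : 0 < r) (hM : 0 ≤ M)
    (hb : ∀ t, 0 ≤ t → ‖S t‖ ≤ M * Real.exp (-r * t)) (B : X →L[𝕜] X) (hB : M * ‖B‖ < r) :
    ∃ U : X →L[𝕜] (ℝ →ᵇ X),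
      (∀ x t, U x t = S (max t 0) x + duhamel S B (U x) t) ∧
      ∀ (x : X) (v : ℝ →ᵇ X), (∀ t, v t = S (max t 0) x + duhamel S B v t) → v = U x := by
  -- With `V` the Duhamel operator and `J x` the free orbit, the mild equation reads `(1 - V) u = J
  -- x`, solved by a Neumann series as `‖V‖ < 1`.
  let V : (ℝ →ᵇ X) →L[𝕜] (ℝ →ᵇ X) := LinearMap.mkContinuous
    { toFun := fun u => BoundedContinuousFunction.ofNormedAddCommGroup (duhamel S B u)
        (hS.continuous_duhamel B u.continuous) (M * ‖B‖ / r * ‖u‖)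
        (norm_duhamel_le hr hM hb B (norm_nonneg u) u.norm_coe_le_norm)
      map_add' := fun u v => by
        ext t
        exact hS.duhamel_add B u.continuous v.continuous t
      map_smul' := fun c u => by
        ext t
        exact duhamel_smul B c u t }
    (M * ‖B‖ / r)
    (fun u => BoundedContinuousFunction.norm_ofNormedAddCommGroup_le _ (by positivity)
      (norm_duhamel_le hr hM hb B (norm_nonneg u) u.norm_coe_le_norm))
  have hS1 : ∀ t : ℝ, ‖S (max t 0)‖ ≤ M := fun t =>
    (hb _ (le_max_right _ _)).trans <| mul_le_of_le_one_right hM <|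
      Real.exp_le_one_iff.2 (by nlinarith [le_max_right t 0])
  let J : X →L[𝕜] (ℝ →ᵇ X) := LinearMap.mkContinuous
    { toFun := fun x => BoundedContinuousFunction.ofNormedAddCommGroup (fun t => S (max t 0) x)
        (hS.continuous_uncurry.comp (continuous_id.prodMk continuous_const)) (M * ‖x‖)
        (fun t => (S _).le_of_opNorm_le (hS1 t) x)
      map_add' := fun x y => by
        ext t
        exact _root_.map_add (S (max t 0)) x y
      map_smul' := fun c x => by
        ext t
        exact map_smul (S (max t 0)) c x }
    M (fun x => BoundedContinuousFunction.norm_ofNormedAddCommGroup_le _ (by positivity)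
      (fun t => (S _).le_of_opNorm_le (hS1 t) x))
  have hV : ‖V‖ < 1 := (LinearMap.mkContinuous_norm_le _ (by positivity) _).trans_lt
    ((div_lt_one hr).2 hB)
  obtain ⟨W, hW⟩ := isUnit_one_sub_of_norm_lt_one hV
  refine ⟨(W⁻¹).1.comp J, fun x t => ?_, fun x v hv => ?_⟩
  · have h1 : (1 - V) ((W⁻¹).1 (J x)) = J x := by
      rw [← hW, ← mul_apply_eq_comp, Units.mul_inv]
      rfl
    have h2 : (W⁻¹).1 (J x) = J x + V ((W⁻¹).1 (J x)) := by
      rw [sub_apply] at h1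
      exact sub_eq_iff_eq_add.1 h1
    exact congrArg (fun f : ℝ →ᵇ X => f t) h2
  · have h1 : (1 - V) v = J x := by
      rw [sub_apply]
      refine sub_eq_iff_eq_add.2 ?_
      ext t
      exact hv t
    rw [ContinuousLinearMap.comp_apply, ← h1, ← hW, ← mul_apply_eq_comp,
      Units.inv_mul]
    rfl

/-- The semigroup law is uniqueness of mild solutions. The generator shifts by `B` because the
Duhamel term divided by `t` tends to `B x`. -/
theorem exists_perturbation_of_decay (hS : IsC0Semigroup S) {M r : ℝ} (hr : 0 < r) (hM : 0 ≤ M)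
    (hb : ∀ t, 0 ≤ t → ‖S t‖ ≤ M * Real.exp (-r * t)) (B : X →L[𝕜] X) (hB : M * ‖B‖ < r) :
    ∃ T : ℝ → X →L[𝕜] X, IsC0Semigroup T ∧
      ∀ x a, IsGeneratorPair T x a ↔ IsGeneratorPair S x (a - B x) := by
  obtain ⟨U, hU, huniq⟩ := hS.exists_mild_solution_operator hr hM hb B hB
  have h0 : ∀ x, U x 0 = x := fun x => by
    rw [hU]
    simp [duhamel, hS.apply_zero]
  have hadd : ∀ s t x, 0 ≤ s → 0 ≤ t → U x (t + s) = U (U x s) t := by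
    intro s t x hs ht
    -- The translated solution, frozen at its time-zero value for negative times so that it
    -- satisfies the truncated equation on all of `ℝ`.
    let v : ℝ →ᵇ X := (U x).compContinuous ⟨fun r => max r 0 + s, by fun_prop⟩
    have hv : v = U (U x s) := by
      refine huniq _ _ fun r => ?_
      have e : v r = U x (max r 0 + s) := rfl
      have hr := le_max_right r 0
      rw [e, hU, hS.apply_add_duhamel B (U x).continuous hs hr,
        max_eq_left (add_nonneg hr hs), hS.apply_add hr hs, ← add_assoc, ← _root_.map_add]
      have h1 : S s x + duhamel S B (U x) s = U x s := by
        rw [hU x s, max_eq_left hs]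
      have h2 : duhamel S B (fun r => U x (max r 0 + s)) (max r 0) = duhamel S B v r := by
        unfold duhamel
        rw [max_eq_left hr]
        rfl
      rw [h1, h2]
    rw [← hv]
    simp [v, ht]
  refine ⟨fun t => (BoundedContinuousFunction.evalCLM 𝕜 t).comp U, ⟨?_, ?_, ?_⟩, fun x a => ?_⟩
  · ext x
    exact h0 x
  · intro s t hs ht
    ext x
    exact hadd t s x ht hs
  · intro x
    have := ((U x).continuous.tendsto 0).mono_left (nhdsWithin_le_nhds (s := Set.Ioi 0))
    rw [h0] at this
    exact this
  · have hd := hS.tendsto_inv_smul_duhamel B (U x).continuous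
    rw [h0] at hd
    have e : ∀ᶠ t : ℝ in 𝓝[>] 0, ((t⁻¹ : ℝ) : 𝕜) • (U x t - x) =
        ((t⁻¹ : ℝ) : 𝕜) • (S t x - x) + ((t⁻¹ : ℝ) : 𝕜) • duhamel S B (U x) t := by
      filter_upwards [self_mem_nhdsWithin] with t ht
      rw [← smul_add, hU x t, max_eq_left (le_of_lt ht)]
      congr 1
      abel
    constructor
    · intro h
      refine (Tendsto.sub h hd).congr' ?_
      filter_upwards [e] with t ht
      change ((t⁻¹ : ℝ) : 𝕜) • (U x t - x) - _ = _
      rw [ht, add_sub_cancel_right]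
    · intro h
      have h2 := Tendsto.add h hd
      rw [sub_add_cancel] at h2
      exact h2.congr' (e.mono fun t ht => ht.symm)

/-- A bounded perturbation of the generator of a `C₀` semigroup generates a `C₀` semigroup. -/
theorem exists_bounded_perturbation (hS : IsC0Semigroup S) (B : X →L[𝕜] X) :
    ∃ T : ℝ → X →L[𝕜] X, IsC0Semigroup T ∧
      ∀ x a, IsGeneratorPair T x a ↔ IsGeneratorPair S x (a - B x) := by
  obtain ⟨M, w, hM, hw, hb⟩ := hS.exists_norm_le_exp
  have hM0 : 0 ≤ M := by linarith
  -- Rescaling by `e^{-(w + r)t}` with `r = M ‖B‖ + 1` makes the decay rate exceed `M ‖B‖`; the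
  -- rescaling is undone at the end.
  have hr : 0 < M * ‖B‖ + 1 := by positivity
  have hS' := hS.exp_smul (-(w + (M * ‖B‖ + 1)))
  obtain ⟨T, hT, hTS⟩ := hS'.exists_perturbation_of_decay hr hM0 (fun t ht => by
    rw [norm_smul, RCLike.norm_ofReal, abs_of_pos (Real.exp_pos _)]
    calc _ ≤ Real.exp (-(w + (M * ‖B‖ + 1)) * t) * (M * Real.exp (w * t)) := by
          gcongr
          exact hb t ht
      _ = M * (Real.exp (-(w + (M * ‖B‖ + 1)) * t) * Real.exp (w * t)) := by ring
      _ = _ := by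
          rw [← Real.exp_add]
          ring_nf) B (by linarith)
  refine ⟨_, hT.exp_smul (w + (M * ‖B‖ + 1)), fun x a => ?_⟩
  rw [IsGeneratorPair.iff_exp_smul hT, hTS, IsGeneratorPair.iff_exp_smul hS]
  have e : a - ((w + (M * ‖B‖ + 1) : ℝ) : 𝕜) • x - B x -
      ((-(w + (M * ‖B‖ + 1)) : ℝ) : 𝕜) • x = a - B x := by
    rw [RCLike.ofReal_neg, neg_smul]
    abel
  rw [e]

end IsC0Semigroup

end Perturbation

/-! ### Symmetric semigroups, convexity and the Lyapunov estimate. -/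

section SymmetricSemigroup

variable {𝕜 X : Type*} [RCLike 𝕜] [NormedAddCommGroup X] [InnerProductSpace 𝕜 X]
  {S : ℝ → X →L[𝕜] X}

namespace IsC0Semigroup

/-- A `C₀` semigroup with densely defined symmetric generator consists of symmetric operators. -/
theorem inner_apply_comm [CompleteSpace X] [NormedSpace ℝ X] [IsScalarTower ℝ 𝕜 X]
    (hS : IsC0Semigroup S)
    (hdense : Dense {x | ∃ a, IsGeneratorPair S x a})
    (hsymm : ∀ x a y b, IsGeneratorPair S x a → IsGeneratorPair S y b →
      inner 𝕜 a y = inner 𝕜 x b) {t : ℝ} (ht : 0 ≤ t) (x y : X) :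
    inner 𝕜 (S t x) y = inner 𝕜 x (S t y) := by
  have key : ∀ x a y b, IsGeneratorPair S x a → IsGeneratorPair S y b →
      inner 𝕜 (S t x) y = inner 𝕜 x (S t y) := by
    intro x a y b hx hy
    -- The function `s ↦ ⟨S (t - s) x, S s y⟩` has zero right derivative by symmetry; its values at
    -- `0` and `t` are the two sides.
    have hcont : ContinuousOn (fun s => inner 𝕜 (S (t - s) x) (S s y)) (Set.Icc 0 t) := by
      refine ContinuousOn.inner ?_ ?_
      · exact (hS.continuousOn_apply x).comp (by fun_prop)
          fun s hs => Set.mem_Ici.2 (sub_nonneg.2 hs.2)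
      · exact (hS.continuousOn_apply y).mono fun s hs => hs.1
    have hder : ∀ s ∈ Set.Ico 0 t,
        HasDerivWithinAt (fun s => inner 𝕜 (S (t - s) x) (S s y)) 0 (Set.Ici s) s := by
      intro s hs
      have h := (hx.hasDerivWithinAt_const_sub hS hs.2).inner 𝕜 (hy.hasDerivWithinAt hS hs.1)
      rw [inner_neg_left, hsymm _ _ _ _ (hx.map hS (sub_nonneg.2 hs.2.le)) (hy.map hS hs.1),
        add_neg_cancel] at h
      exact h
    have h := constant_of_has_deriv_right_zero hcont hder t ⟨ht, le_rfl⟩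
    simpa [hS.apply_zero] using h.symm
  have hx : ∀ x a, IsGeneratorPair S x a → ∀ y, inner 𝕜 (S t x) y = inner 𝕜 x (S t y) := by
    intro x a hx y
    refine congrFun (Continuous.ext_on hdense (f := fun y => inner 𝕜 (S t x) y)
      (g := fun y => inner 𝕜 x (S t y)) (by fun_prop) (by fun_prop) ?_) y
    rintro y ⟨b, hy⟩
    exact key x a y b hx hy
  refine congrFun (Continuous.ext_on hdense (f := fun x => inner 𝕜 (S t x) y)
    (g := fun x => inner 𝕜 x (S t y)) (by fun_prop) (by fun_prop) ?_) x
  rintro x ⟨a, h⟩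
  exact hx x a h y

theorem re_inner_apply_self (hS : IsC0Semigroup S)
    (hsymm : ∀ t, 0 ≤ t → ∀ x y, inner 𝕜 (S t x) y = inner 𝕜 x (S t y)) {t : ℝ} (ht : 0 ≤ t)
    (x : X) : RCLike.re (inner 𝕜 (S t x) x) = ‖S (t / 2) x‖ ^ 2 := by
  have ht' : 0 ≤ t / 2 := by positivity
  conv_lhs => rw [← add_halves t, hS.apply_add ht' ht', hsymm _ ht']
  exact inner_self_eq_norm_sq _

/-- The convexity inequality `1 - tH ≤ e^{-tH}`. -/
theorem norm_sq_add_le_re_inner (hS : IsC0Semigroup S)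
    (hsymm : ∀ t, 0 ≤ t → ∀ x y, inner 𝕜 (S t x) y = inner 𝕜 x (S t y)) {t : ℝ} (ht : 0 ≤ t)
    {x a : X} (hx : IsGeneratorPair S x a) :
    ‖x‖ ^ 2 + t * RCLike.re (inner 𝕜 a x) ≤ RCLike.re (inner 𝕜 (S t x) x) := by
  rcases ht.eq_or_lt with rfl | htpos
  · rw [hS.apply_zero, zero_mul, add_zero]
    exact (inner_self_eq_norm_sq (𝕜 := 𝕜) x).ge
  -- Midpoint convexity of `f s = ⟨S s x, x⟩` at `0`: since `f s = ‖S (s/2) x‖²`, expand `‖S (s/2) x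
  -- - x‖² ≥ 0`.
  have hmid : ∀ s, 0 ≤ s → 2 * RCLike.re (inner 𝕜 (S (s / 2) x - x) x) ≤
      RCLike.re (inner 𝕜 (S s x - x) x) := by
    intro s hs
    have h1 := hS.re_inner_apply_self hsymm hs x
    have h2 : (0 : ℝ) ≤ ‖S (s / 2) x - x‖ ^ 2 := by positivity
    rw [norm_sub_sq (𝕜 := 𝕜)] at h2
    simp only [inner_sub_left, map_sub, inner_self_eq_norm_sq]
    linarith
  -- Repeated halving keeps the difference quotients of `f` at `0` below the one at `t`; their limit
  -- is the derivative.
  have hit : ∀ n : ℕ, 2 ^ n * RCLike.re (inner 𝕜 (S (t / 2 ^ n) x - x) x) ≤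
      RCLike.re (inner 𝕜 (S t x - x) x) := by
    intro n
    induction n with
    | zero => simp
    | succ n ih =>
      refine le_trans ?_ ih
      have := hmid (t / 2 ^ n) (by positivity)
      rw [div_div, ← pow_succ] at this
      rw [pow_succ, mul_assoc]
      exact mul_le_mul_of_nonneg_left this (by positivity)
  have hlim : Tendsto (fun n : ℕ => t / 2 ^ n) atTop (𝓝[>] 0) := by
    refine tendsto_nhdsWithin_iff.2 ⟨?_, Eventually.of_forall fun n => Set.mem_Ioi.2 (by positivity)⟩
    exact tendsto_const_nhds.div_atTop (tendsto_pow_atTop_atTop_of_one_lt one_lt_two)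
  have hq : Tendsto (fun n : ℕ => t * RCLike.re
      (inner 𝕜 ((((t / 2 ^ n)⁻¹ : ℝ) : 𝕜) • (S (t / 2 ^ n) x - x)) x)) atTop
      (𝓝 (t * RCLike.re (inner 𝕜 a x))) :=
    ((RCLike.continuous_re.tendsto _).comp
      ((hx.comp hlim).inner tendsto_const_nhds)).const_mul t
  have hle := le_of_tendsto' hq (b := RCLike.re (inner 𝕜 (S t x - x) x)) fun n => by
    refine le_trans (le_of_eq ?_) (hit n)
    rw [inner_smul_left, RCLike.conj_ofReal, RCLike.re_ofReal_mul]
    field_simp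
  rw [inner_sub_left, map_sub, inner_self_eq_norm_sq] at hle
  linarith

/-- The convexity bound for `e^t S t`, whose generator is shifted by `1`. The gain is the extra `t
‖x‖²`, which later absorbs the error terms. -/
theorem exp_mul_le_re_inner (hS : IsC0Semigroup S)
    (hsymm : ∀ t, 0 ≤ t → ∀ x y, inner 𝕜 (S t x) y = inner 𝕜 x (S t y)) {t : ℝ} (ht : 0 ≤ t)
    {x a : X} (hx : IsGeneratorPair S x a) :
    Real.exp (-t) * ((1 + t) * ‖x‖ ^ 2 + t * RCLike.re (inner 𝕜 a x)) ≤
      RCLike.re (inner 𝕜 (S t x) x) := by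
  have h := (hS.exp_smul 1).norm_sq_add_le_re_inner (fun t ht x y => by
    simp only [smul_apply, inner_smul_left, inner_smul_right, RCLike.conj_ofReal, hsymm t ht]) ht
    (hx.exp_smul hS 1)
  rw [smul_apply, inner_smul_left, RCLike.conj_ofReal, RCLike.re_ofReal_mul, one_mul,
    RCLike.ofReal_one, one_smul, inner_add_left, _root_.map_add, inner_self_eq_norm_sq] at h
  rw [Real.exp_neg, inv_mul_le_iff₀ (Real.exp_pos t)]
  linarith

end IsC0Semigroup

/-- Here `E = e^{-2m}`, `p = ‖S m y‖`, `q = ‖χ S m y‖`, `Y = ‖y‖`, and `D`, `A`, `Z` are the real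
parts of `⟨S m y, a⟩`, `⟨y, a⟩`, `⟨y, χ S m y⟩`. After multiplication by `m`, the feedback's `-8 C²
q²` pays `4 C² q²` for `2 p²` and `4 C² q²` for the cross term `Z`. -/
theorem lyapunov_scalar_estimate {m C eps E M p q Y A D Z : ℝ} (hm : 0 < m) (hC : 1 ≤ C)
    (hE : 0 < E) (hp : 0 ≤ p) (hY : 0 ≤ Y) (heps : 0 ≤ eps)
    (hepsE : eps ≤ M * E) (hE1 : E ≤ 1) (hmC : m = 16 * C ^ 2 * (M ^ 2 + 1))
    (hD : m * D ≤ p ^ 2) (hA : E * ((1 + 2 * m) * Y ^ 2 + 2 * m * A) ≤ p ^ 2)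
    (hpq : p ≤ C * q + (C + 1) * eps * Y) (hZ : -Z ≤ Y * q) :
    D - 8 * C ^ 2 / m * q ^ 2 + 2 * E * (A - 8 * C ^ 2 / m * Z) ≤ -(E / m) * Y ^ 2 := by
  have hC2 : 0 < C ^ 2 := by positivity
  have h1 : p ^ 2 ≤ 2 * C ^ 2 * q ^ 2 + 8 * C ^ 2 * eps ^ 2 * Y ^ 2 := by
    have h2 : p ≤ C * (q + 2 * (eps * Y)) := by nlinarith [mul_nonneg heps hY]
    have h3 : p ^ 2 ≤ (C * (q + 2 * (eps * Y))) ^ 2 := pow_le_pow_left₀ hp h2 2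
    nlinarith [mul_nonneg hC2.le (sq_nonneg (q - 2 * (eps * Y)))]
  have h4 : eps ^ 2 ≤ M ^ 2 * E ^ 2 := by
    rw [← mul_pow]
    exact pow_le_pow_left₀ heps hepsE 2
  have hEE : E ^ 2 ≤ E := by nlinarith
  -- This fixes `m`: the remaining `Y²` errors are quadratic in `E` and fit into the `2 m E Y²`
  -- supplied by `hA`.
  have h5 : 16 * C ^ 2 * eps ^ 2 + 16 * C ^ 2 * E ^ 2 ≤ m * E := by
    calc 16 * C ^ 2 * eps ^ 2 + 16 * C ^ 2 * E ^ 2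
        ≤ 16 * C ^ 2 * (M ^ 2 * E ^ 2) + 16 * C ^ 2 * E ^ 2 := by gcongr
      _ = m * E ^ 2 := by rw [hmC]; ring
      _ ≤ m * E := by gcongr
  have h5' := mul_le_mul_of_nonneg_right h5 (sq_nonneg Y)
  have h6 : -(2 * E * Z) ≤ q ^ 2 / 2 + 2 * E ^ 2 * Y ^ 2 := by
    nlinarith [sq_nonneg (q - 2 * E * Y), mul_le_mul_of_nonneg_left hZ (by positivity : 0 ≤ 2 * E)]
  have h6' := mul_le_mul_of_nonneg_left h6 (by positivity : 0 ≤ 8 * C ^ 2)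
  have key : m * (D - 8 * C ^ 2 / m * q ^ 2 + 2 * E * (A - 8 * C ^ 2 / m * Z)) ≤
      m * (-(E / m) * Y ^ 2) := by
    have e1 : m * (D - 8 * C ^ 2 / m * q ^ 2 + 2 * E * (A - 8 * C ^ 2 / m * Z)) =
        m * D - 8 * C ^ 2 * q ^ 2 + 2 * E * (m * A) - 8 * C ^ 2 * (2 * E * Z) := by
      field_simp
      ring
    have e2 : m * (-(E / m) * Y ^ 2) = -(E * Y ^ 2) := by
      field_simp
    rw [e1, e2]
    have h7 : 0 ≤ E * m * Y ^ 2 := by positivity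
    linarith
  exact le_of_mul_le_mul_left key hm

/-- Dissipation of the quadratic form `⟨(S m + 2 e^{-2m}) y, y⟩` along the closed loop generator
`a ↦ a - (8 C² / m) χ S(m) y`. -/
theorem lyapunov_dissipation (hS : IsC0Semigroup S)
    (hsymm : ∀ t, 0 ≤ t → ∀ x y, inner 𝕜 (S t x) y = inner 𝕜 x (S t y))
    {χ P : X →L[𝕜] X} (hχ : ∀ x, ‖χ x‖ ≤ ‖x‖)
    (hχ' : ∀ x, RCLike.re (inner 𝕜 x (χ x)) = ‖χ x‖ ^ 2)
    {m C M : ℝ} (hC : 1 ≤ C) (hM : 0 < M) (hm : m = 16 * C ^ 2 * (M ^ 2 + 1))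
    (hspec : ∀ x, ‖P x‖ ≤ C * ‖χ (P x)‖)
    (hdiss : ∀ x, ‖S m x - P (S m x)‖ ≤ M * Real.exp (-(2 * m)) * ‖x‖)
    {y a : X} (hy : IsGeneratorPair S y a) :
    RCLike.re (inner 𝕜 (S m y) (a - ((8 * C ^ 2 / m : ℝ) : 𝕜) • χ (S m y))) +
      2 * Real.exp (-(2 * m)) *
        RCLike.re (inner 𝕜 y (a - ((8 * C ^ 2 / m : ℝ) : 𝕜) • χ (S m y))) ≤
      -(Real.exp (-(2 * m)) / m) * ‖y‖ ^ 2 := by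
  have hm0 : 0 < m := by rw [hm]; positivity
  have hm2 : 0 ≤ m / 2 := by positivity
  have hhalf : ∀ x, S m x = S (m / 2) (S (m / 2) x) := fun x => by
    rw [← hS.apply_add hm2 hm2, add_halves]
  -- Convexity over time `m`, applied to `S (m / 2) y`; symmetry turns each pairing into one with `S
  -- m y`.
  have hD : m * RCLike.re (inner 𝕜 (S m y) a) ≤ ‖S m y‖ ^ 2 := by
    have h := hS.norm_sq_add_le_re_inner hsymm hm0.le (hy.map hS hm2)
    rw [hS.re_inner_apply_self hsymm hm0.le, ← hhalf, hsymm _ hm2, ← hhalf,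
      inner_re_symm] at h
    nlinarith [sq_nonneg ‖S (m / 2) y‖]
  have hA : Real.exp (-(2 * m)) *
      ((1 + 2 * m) * ‖y‖ ^ 2 + 2 * m * RCLike.re (inner 𝕜 y a)) ≤ ‖S m y‖ ^ 2 := by
    have h := hS.exp_mul_le_re_inner hsymm (t := 2 * m) (by positivity) hy
    rwa [hS.re_inner_apply_self hsymm (by positivity), mul_div_cancel_left₀ m two_ne_zero,
      inner_re_symm] at h
  -- Split `S m y` by `P`, apply the spectral inequality to the `P` part, then replace `χ P S m y`
  -- by `χ S m y`; the remainder enters `1 + C` times.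
  have hpq : ‖S m y‖ ≤ C * ‖χ (S m y)‖ + (C + 1) * (M * Real.exp (-(2 * m))) * ‖y‖ := by
    have h1 : ‖S m y‖ ≤ ‖P (S m y)‖ + ‖S m y - P (S m y)‖ := by
      simpa using norm_add_le (P (S m y)) (S m y - P (S m y))
    have h2 : ‖χ (P (S m y))‖ ≤ ‖χ (S m y)‖ + ‖S m y - P (S m y)‖ := by
      have h3 := norm_sub_le (χ (S m y)) (χ (S m y - P (S m y)))
      rw [map_sub, sub_sub_cancel, ← map_sub] at h3
      exact h3.trans (by gcongr; exact hχ _)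
    have h4 := mul_le_mul_of_nonneg_left h2 (by linarith : 0 ≤ C)
    have h5 := mul_le_mul_of_nonneg_left (hdiss y) (by linarith : 0 ≤ C + 1)
    linarith [hspec (S m y)]
  have hZ : -RCLike.re (inner 𝕜 y (χ (S m y))) ≤ ‖y‖ * ‖χ (S m y)‖ :=
    (neg_le_abs _).trans ((RCLike.abs_re_le_norm _).trans (norm_inner_le_norm _ _))
  have h := lyapunov_scalar_estimate hm0 hC (Real.exp_pos _) (norm_nonneg _) (norm_nonneg y)
    (by positivity : 0 ≤ M * Real.exp (-(2 * m))) le_rfl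
    (Real.exp_le_one_iff.2 (by linarith)) hm hD hA hpq hZ
  simpa only [inner_sub_right, inner_smul_right, map_sub, RCLike.re_ofReal_mul, hχ'] using h

/-- The form `⟨R y, y⟩ + d ‖y‖²` is equivalent to `‖y‖²`, so `hdec` is a Gronwall inequality for
orbits in the domain; density extends the bound. -/
theorem exists_exp_decay_of_lyapunov [CompleteSpace X] [NormedSpace ℝ X] [IsScalarTower ℝ 𝕜 X]
    {T : ℝ → X →L[𝕜] X} (hT : IsC0Semigroup T)
    (hdense : Dense {x | ∃ a, IsGeneratorPair T x a}) {R : X →L[𝕜] X}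
    (hR : ∀ x y, inner 𝕜 (R x) y = inner 𝕜 x (R y)) (hR0 : ∀ x, 0 ≤ RCLike.re (inner 𝕜 (R x) x))
    {d k : ℝ} (hd : 0 < d) (hk : 0 < k)
    (hdec : ∀ y a, IsGeneratorPair T y a →
      RCLike.re (inner 𝕜 (R y) a) + d * RCLike.re (inner 𝕜 y a) ≤ -k * ‖y‖ ^ 2) :
    ∃ M w : ℝ, 0 < M ∧ 0 < w ∧ ∀ t : ℝ, 0 ≤ t → ‖T t‖ ≤ M * Real.exp (-w * t) := by
  let L : X → ℝ := fun y => RCLike.re (inner 𝕜 (R y) y) + d * ‖y‖ ^ 2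
  have hN : 0 < ‖R‖ + d := by positivity
  have hL1 : ∀ y, d * ‖y‖ ^ 2 ≤ L y := fun y => by linarith [hR0 y]
  have hL2 : ∀ y, L y ≤ (‖R‖ + d) * ‖y‖ ^ 2 := fun y => by
    have h : RCLike.re (inner 𝕜 (R y) y) ≤ ‖R‖ * ‖y‖ * ‖y‖ :=
      (re_inner_le_norm _ _).trans (by gcongr; exact R.le_opNorm y)
    simp only [L]
    nlinarith
  have hcont : ∀ x, ContinuousOn (fun t => L (T t x)) (Set.Ici 0) := fun x =>
    (show Continuous L by fun_prop).comp_continuousOn (hT.continuousOn_apply x)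
  have hder : ∀ x a, IsGeneratorPair T x a → ∀ t, 0 ≤ t →
      HasDerivWithinAt (fun t => L (T t x))
        (2 * (RCLike.re (inner 𝕜 (R (T t x)) (T t a)) + d * RCLike.re (inner 𝕜 (T t x) (T t a))))
        (Set.Ici t) t := by
    intro x a hx t ht
    have h0 := hx.hasDerivWithinAt hT ht
    have h1 : HasDerivWithinAt (fun t => R (T t x)) (R (T t a)) (Set.Ici t) t :=
      ((R.restrictScalars ℝ).hasFDerivAt.comp_hasDerivWithinAt t h0)
    have h2 := (RCLike.reCLM (K := 𝕜)).hasFDerivAt.comp_hasDerivWithinAt t (h1.inner 𝕜 h0)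
    have h3 := (RCLike.reCLM (K := 𝕜)).hasFDerivAt.comp_hasDerivWithinAt t (h0.inner 𝕜 h0)
    have h4 := h2.add (h3.const_mul d)
    have e : (fun t => L (T t x)) = (⇑(RCLike.reCLM (K := 𝕜)) ∘ fun t => inner 𝕜 (R (T t x)) (T t x)) +
        fun t => d * (⇑(RCLike.reCLM (K := 𝕜)) ∘ fun t => inner 𝕜 (T t x) (T t x)) t := by
      funext s
      simp only [L, Pi.add_apply, Function.comp_apply, RCLike.reCLM_apply, inner_self_eq_norm_sq]
    rw [e]
    refine h4.congr_deriv ?_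
    simp only [RCLike.reCLM_apply, _root_.map_add]
    rw [hR (T t a), inner_re_symm (T t a) (R _), inner_re_symm (T t a) (T t x)]
    ring
  have hbound : ∀ x a, IsGeneratorPair T x a → ∀ t, 0 ≤ t →
      L (T t x) ≤ L x * Real.exp (-(2 * k / (‖R‖ + d)) * t) := by
    intro x a hx t ht
    have h := le_gronwallBound_of_liminf_deriv_right_le (δ := L x)
      (K := -(2 * k / (‖R‖ + d))) (ε := 0)
      ((hcont x).mono fun _ hs => hs.1)
      (fun s hs r hr => ((hder x a hx s hs.1).liminf_right_slope_le hr).mono fun z hz => by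
        simpa [slope_def_field, div_eq_inv_mul] using hz)
      (by rw [hT.apply_zero]) (fun s hs => by
        have h1 := hdec _ _ (hx.map hT hs.1)
        have h2 := hL2 (T s x)
        have h3 : 2 * k / (‖R‖ + d) * L (T s x) ≤ 2 * k * ‖T s x‖ ^ 2 := by
          rw [div_mul_eq_mul_div, div_le_iff₀ hN]
          nlinarith
        linarith) t ⟨ht, le_rfl⟩
    rwa [gronwallBound_ε0, sub_zero] at h
  -- Square roots of the ratio of the equivalence constants and of the Gronwall factor, since the
  -- form is quadratic.
  refine ⟨√((‖R‖ + d) / d), k / (‖R‖ + d), by positivity, by positivity, fun t ht => ?_⟩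
  refine (T t).opNorm_le_bound (by positivity) fun x => ?_
  have hclosed : IsClosed {x | ‖T t x‖ ≤
      √((‖R‖ + d) / d) * Real.exp (-(k / (‖R‖ + d)) * t) * ‖x‖} :=
    isClosed_le (by fun_prop) (by fun_prop)
  refine hclosed.closure_subset_iff.2 ?_ (hdense x)
  rintro x ⟨a, hx⟩
  refine (sq_le_sq₀ (norm_nonneg _) (by positivity)).1 ?_
  rw [mul_pow, mul_pow, Real.sq_sqrt (by positivity), ← Real.exp_nat_mul, div_mul_eq_mul_div,
    div_mul_eq_mul_div, le_div_iff₀ hd]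
  calc ‖T t x‖ ^ 2 * d ≤ L (T t x) := by linarith [hL1 (T t x)]
    _ ≤ L x * Real.exp (-(2 * k / (‖R‖ + d)) * t) := hbound x a hx t ht
    _ ≤ (‖R‖ + d) * ‖x‖ ^ 2 * Real.exp (-(2 * k / (‖R‖ + d)) * t) := by
        gcongr
        exact hL2 x
    _ = _ := by
        push_cast
        ring_nf

end SymmetricSemigroup

/-! ### Multiplication by the characteristic function on `L²`. -/

section EuclideanL2

variable {𝕜 : Type*} [RCLike 𝕜] {n : ℕ} {E : Set (EuclideanSpace ℝ (Fin n))}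

theorem norm_chiMul_le (hE : NullMeasurableSet E volume) (f : L2Rn 𝕜 n) :
    ‖chiMul 𝕜 hE f‖ ≤ ‖f‖ := by
  apply Lp.norm_le_norm_of_ae_le
  filter_upwards [chiMul_coeFn hE f] with x hx
  rw [hx]
  exact norm_indicator_le_norm_self _ _

theorem norm_chiMul (hE : NullMeasurableSet E volume) (f : L2Rn 𝕜 n) :
    ‖chiMul 𝕜 hE f‖ = normOn E f := by
  -- `E` is only null measurable, so the restriction formula is applied to a measurable set equal to
  -- it almost everywhere.
  obtain ⟨F, -, hF, hFE⟩ := hE.exists_measurable_superset_ae_eq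
  rw [Lp.norm_def, normOn, eLpNorm_congr_ae (chiMul_coeFn hE f),
    eLpNorm_congr_ae (indicator_ae_eq_of_ae_eq_set hFE.symm),
    eLpNorm_indicator_eq_eLpNorm_restrict hF, Measure.restrict_congr_set hFE]

theorem re_inner_chiMul_self (hE : NullMeasurableSet E volume) (f : L2Rn 𝕜 n) :
    RCLike.re (inner 𝕜 f (chiMul 𝕜 hE f)) = ‖chiMul 𝕜 hE f‖ ^ 2 := by
  rw [← inner_self_eq_norm_sq (𝕜 := 𝕜), L2.inner_def, L2.inner_def]
  congr 1
  refine integral_congr_ae ?_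
  filter_upwards [chiMul_coeFn hE f] with x hx
  rw [hx]
  by_cases h : x ∈ E
  · rw [Set.indicator_of_mem h]
  · rw [Set.indicator_of_notMem h, inner_zero_right, inner_zero_right]

end EuclideanL2

/-! ### Graphs of unbounded operators and the stabilization theorem. -/

theorem LinearPMap.mem_graph_neg_iff {R X : Type*} [Ring R] [AddCommGroup X] [Module R X]
    (A : X →ₗ.[R] X) (x y : X) : (x, y) ∈ (-A).graph ↔ (x, -y) ∈ A.graph := by
  simp only [LinearPMap.mem_graph_iff]
  constructor
  · rintro ⟨z, rfl, h⟩
    exact ⟨z, rfl, by rw [← h, LinearPMap.neg_apply, neg_neg]⟩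
  · rintro ⟨z, rfl, h⟩
    exact ⟨z, rfl, by rw [LinearPMap.neg_apply, h, neg_neg]⟩

theorem LinearPMap.mem_graph_sub_toPMap_iff {R X : Type*} [Ring R] [AddCommGroup X] [Module R X]
    (A : X →ₗ.[R] X) (B : X →ₗ[R] X) (x y : X) :
    (x, y) ∈ (A - B.toPMap ⊤).graph ↔ (x, y + B x) ∈ A.graph := by
  simp only [LinearPMap.mem_graph_iff]
  constructor
  · rintro ⟨z, rfl, h⟩
    refine ⟨⟨z, z.2.1⟩, rfl, ?_⟩
    rw [← h, LinearPMap.sub_apply]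
    simp
  · rintro ⟨z, rfl, h⟩
    refine ⟨⟨z, z.2, trivial⟩, rfl, ?_⟩
    rw [LinearPMap.sub_apply]
    simpa [sub_eq_iff_eq_add] using h

theorem exists_pnat_mul_rpow_ge {c b : ℝ} (hc : 0 < c) (hb : 0 < b) (r : ℝ) :
    ∃ k : ℕ+, r ≤ c * ((k : ℕ) : ℝ) ^ b := by
  have h := ((tendsto_rpow_atTop hb).comp tendsto_natCast_atTop_atTop).const_mul_atTop hc
  obtain ⟨k, hk, hk0⟩ := ((h.eventually_ge_atTop r).and (eventually_gt_atTop 0)).exists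
  exact ⟨⟨k, hk0⟩, hk⟩

theorem lemma2p1 {𝕜 : Type*} [RCLike 𝕜] (n : ℕ)
    (H : L2Rn 𝕜 n →ₗ.[𝕜] L2Rn 𝕜 n) (hH : IsSelfAdjoint H)
    (S : ℝ → L2Rn 𝕜 n →L[𝕜] L2Rn 𝕜 n) (hS : GeneratesC0 (-H) S)
    (E : Set (EuclideanSpace ℝ (Fin n))) (hE : NullMeasurableSet E volume)
    (P : ℕ+ → L2Rn 𝕜 n →L[𝕜] L2Rn 𝕜 n) (hP : ∀ k, IsStarProjection (P k))
    (c₁ c₂ a b M : ℝ) (hc₁ : 0 < c₁) (hc₂ : 0 < c₂) (ha : 0 < a) (hb : 0 < b) (hM : 0 < M)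
    (hspec : ∀ (k : ℕ+) (φ : L2Rn 𝕜 n),
      ‖P k φ‖ ≤ Real.exp (c₁ * ((k : ℕ) : ℝ) ^ a) * normOn E (P k φ))
    (hdiss : ∀ (k : ℕ+) (φ : L2Rn 𝕜 n) (t : ℝ), 0 < t →
      ‖S t φ - P k (S t φ)‖ ≤ M * Real.exp (-c₂ * t * ((k : ℕ) : ℝ) ^ b) * ‖φ‖) :
    IsStabilizableSet H hE := by
  obtain ⟨hC0, hgen⟩ := hS
  have hpair : ∀ x y, IsGeneratorPair S x y ↔ (x, -y) ∈ H.graph := fun x y => by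
    rw [← LinearPMap.mem_graph_neg_iff]
    exact (hgen x y).symm
  have hdense : Dense {x | ∃ y, IsGeneratorPair S x y} := by
    refine hH.dense_domain.mono fun x hx => ⟨-H ⟨x, hx⟩, ?_⟩
    rw [hpair, neg_neg]
    exact H.mem_graph ⟨x, hx⟩
  have hsymm : ∀ t, 0 ≤ t → ∀ x y, inner 𝕜 (S t x) y = inner 𝕜 x (S t y) := by
    refine fun t ht => hC0.inner_apply_comm hdense (fun x u y v hx hy => ?_) ht
    rw [hpair, LinearPMap.mem_graph_iff] at hx hy
    obtain ⟨x', rfl, hx'⟩ := hx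
    obtain ⟨y', rfl, hy'⟩ := hy
    have hf : H.IsFormalAdjoint H := by
      have h := LinearPMap.adjoint_isFormalAdjoint hH.dense_domain
      rwa [LinearPMap.isSelfAdjoint_def.1 hH] at h
    have h := hf x' y'
    rw [hx', hy', inner_neg_left, inner_neg_right] at h
    exact neg_injective h
  -- The threshold `2` turns the dissipation at time `m` into `M e^{-2m}`, matching the weight in
  -- the Lyapunov form for every `m > 0`.
  obtain ⟨k, hk⟩ := exists_pnat_mul_rpow_ge hc₂ hb 2
  obtain ⟨C, hC⟩ : ∃ C, C = Real.exp (c₁ * ((k : ℕ) : ℝ) ^ a) := ⟨_, rfl⟩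
  have hC1 : 1 ≤ C := by
    rw [hC]
    exact Real.one_le_exp (by positivity)
  obtain ⟨m, hm⟩ : ∃ m, m = 16 * C ^ 2 * (M ^ 2 + 1) := ⟨_, rfl⟩
  have hm0 : 0 < m := by rw [hm]; positivity
  let K : L2Rn 𝕜 n →L[𝕜] L2Rn 𝕜 n := -(((8 * C ^ 2 / m : ℝ) : 𝕜) • S m)
  have hK : ∀ y, chiMul 𝕜 hE (K y) = -(((8 * C ^ 2 / m : ℝ) : 𝕜) • chiMul 𝕜 hE (S m y)) :=
    fun y => by simp [K]
  obtain ⟨T, hT, hTS⟩ := hC0.exists_bounded_perturbation ((chiMul 𝕜 hE).comp K)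
  refine ⟨K, T, ⟨hT, fun x y => ?_⟩, ?_⟩
  · rw [LinearPMap.mem_graph_neg_iff, LinearPMap.mem_graph_sub_toPMap_iff]
    refine Iff.trans ?_ (hTS x y).symm
    rw [hpair, neg_sub, sub_eq_neg_add]
    rfl
  · refine exists_exp_decay_of_lyapunov hT ?_ (R := S m) (hsymm m hm0.le) (fun x => ?_)
      (d := 2 * Real.exp (-(2 * m))) (k := Real.exp (-(2 * m)) / m) (by positivity)
      (by positivity) fun y v hy => ?_
    · refine hdense.mono ?_
      rintro x ⟨y, hy⟩
      -- A bounded perturbation leaves the domain unchanged.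
      refine ⟨y + (chiMul 𝕜 hE).comp K x, (hTS _ _).2 ?_⟩
      rwa [add_sub_cancel_right]
    · rw [hC0.re_inner_apply_self hsymm hm0.le]
      positivity
    · have h := lyapunov_dissipation hC0 hsymm (P := P k) (norm_chiMul_le hE)
        (re_inner_chiMul_self hE) hC1 hM hm (fun x => ?_) (fun x => ?_) ((hTS y v).1 hy)
      · rw [ContinuousLinearMap.comp_apply, hK, sub_neg_eq_add, add_sub_cancel_right] at h
        exact h
      · rw [norm_chiMul, hC]
        exact hspec k x
      · refine (hdiss k x m hm0).trans ?_
        gcongr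
        nlinarith
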